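/- **Setting.** Fix a countably infinite set $\mathcal C$ of constants. A *database instance* over a finite relational schema $\mathcal R$ is a finite set of facts over $\mathcal C$; $\mathrm{adom}(I)$ is the set of constants occurring in $I$. A *DCDS* consists of - a data layer: a finite schema $\mathcal R$, an initial instance $I_0$, and a finite set $\mathcal E$ of equality constraints $Q\to\bigwedge_j z_j=y_j$ satisfied by $I_0$, where $Q$ is a first-order query and each $z_j,y_j$ is a free variable of $Q$ or a constant; - a process layer: a finite set $\mathcal F$ of service symbols with arities, a finite set of actions and a finite set of rules $Q\mapsto\alpha$, where $Q$ is a first-order query whose free variables are exactly the parameters of the action $\alpha$. An action has finitely many parameters and finitely many effects $q^+\wedge Q^-\rightsquigarrow E$, where $q^+$ is a union of conjunctive queries, $Q^-$ is a first-order formula with free variables among those of $q^+$ (both may also mention the action parameters), and $E$ is a finite set of facts whose arguments are constants, parameters, free variables of $q^+$, or service calls $f(\vec t)$, $f\in\mathcal F$, with $\vec t$ made of constants, parameters and free variables of $q^+$. All constants in queries, constraints and effects belong to $\mathrm{adom}(I_0)$. Queries over an instance $I$ are evaluated over the domain $\mathrm{adom}(I)\cup\mathrm{adom}(I_0)$ (both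 for free and for quantified variables). **Deterministic semantics.** A state is a pair $\langle I,M\rangle$ of an instance $I$ and a partial function $M$ from ground service calls to $\mathcal C$. For a rule $Q\mapsto\alpha$ and an answer $\sigma$ to $Q$ over $I$, let $\mathrm{DO}(I,\alpha\sigma)$ be the union of all $E\sigma\theta$ over the effects $q^+\wedge Q^-\rightsquigarrow E$ of $\alpha$ and the answers $\theta$ to $(q^+\wedge Q^-)\sigma$ over $I$. Then $\langle I,M\rangle\Rightarrow\langle I',M'\rangle$ if, for some such rule and $\sigma$, $M'$ extends $M$ by assigning an arbitrary constant to each service call that occurs in $\mathrm{DO}(I,\alpha\sigma)$ and is not in the domain of $M$, $I'$ results from $\mathrm{DO}(I,\alpha\sigma)$ by replacing each service call by its value under $M'$, and $I'$ satisfies $\mathcal E$. The *concrete transition system* $\Upsilon_{\mathcal S}$ of a DCDS $\mathcal S$ consists of the states reachable from $s_0=\langle I_0,\emptyset\rangle$ with the relation $\Rightarrow$ and the labelling $db(\langle I,M\rangle)=I$. $\mathcal S$ is *run-bounded* if there is $b\in\mathbb N$ such that $\bigl|\bigcup_i\mathrm{adom}(db(s_i))\bigr|<b$ for every finite or infinite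 run $s_0\Rightarrow s_1\Rightarrow\cdots$ of $\Upsilon_{\mathcal S}$. **History-preserving bisimilarity.** Let $\Upsilon_1,\Upsilon_2$ be transition systems whose states are labelled (by $db_1,db_2$) with instances over $\mathcal R$ and $\mathcal C$, with initial states $s_{01},s_{02}$. A history-preserving bisimulation is a set $B$ of triples $\langle s_1,h,s_2\rangle$, with $h$ a partial bijection of $\mathcal C$ that is the identity on $\mathrm{adom}(I_0)$, such that for each $\langle s_1,h,s_2\rangle\in B$: $h$ induces an isomorphism between $db_1(s_1)$ and $db_2(s_2)$; whenever $s_1\Rightarrow_1 s_1'$ there are $s_2'$ and $h'$ extending $h$ with $s_2\Rightarrow_2 s_2'$ and $\langle s_1',h',s_2'\rangle\in B$; and whenever $s_2\Rightarrow_2 s_2'$ there are $s_1'$ and $h'$ extending $h$ with $s_1\Rightarrow_1 s_1'$ and $\langle s_1',h',s_2'\rangle\in B$. Write $\Upsilon_1\approx\Upsilon_2$ if some such $B$ contains $\langle s_{01},h_0,s_{02}\rangle$ for some $h_0$. **Theorem.** For every run-bounded DCDS $\mathcal S$ with deterministic services there is a transition system $\Theta_{\mathcal S}$ (with values in $\mathcal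 C$) having finitely many states such that $\Theta_{\mathcal S}\approx\Upsilon_{\mathcal S}$. -/

import Mathlib

universe u

namespace DCDSys

/-- A finite set of symbols with arities. It serves both as a relational schema and as the set of
service interfaces of a process layer. -/
structure Signature where
  Sym : Type u
  arity : Sym → ℕ
  finite_sym : Finite Sym

/-- `r(t₁, …, tₙ)` for a symbol `r` of arity `n` and arguments in `Δ`. -/
abbrev Fact (R : Signature.{u}) (Δ : Type u) : Type u :=
  Σ r : R.Sym, (Fin (R.arity r) → Δ)

/-- A (finite) database instance over the schema `R` with values in `Δ`. -/
abbrev Instance (R : Signature.{u}) (Δ : Type u) : Type u :=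
  Finset (Fact R Δ)

/-- The active domain of an instance: the values that occur in it. -/
def adom {R : Signature.{u}} {Δ : Type u} (I : Instance R Δ) : Set Δ :=
  {c | ∃ e ∈ I, ∃ i, e.2 i = c}

/-! ### First-order queries -/

/-- Terms of queries: variables, action parameters (of which there are `n`) and constants. -/
inductive Term (C : Type u) (n : ℕ) : Type u where
  | var (x : ℕ) : Term C n
  | par (p : Fin n) : Term C n
  | const (c : C) : Term C n

namespace Term

variable {C : Type u} {n : ℕ}

/-- The value of a term under values `σ` of the parameters and `θ` of the variables. -/
def eval (σ : Fin n → C) (θ : ℕ → C) : Term C n → C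
  | var x => θ x
  | par p => σ p
  | const c => c

def vars : Term C n → Set ℕ
  | var x => {x}
  | par _ => ∅
  | const _ => ∅

def params : Term C n → Set (Fin n)
  | var _ => ∅
  | par p => {p}
  | const _ => ∅

def consts : Term C n → Set C
  | var _ => ∅
  | par _ => ∅
  | const c => {c}

end Term

/-- First-order formulas over the schema `R`, with constants in `C` and `n` parameters. The other
connectives and the universal quantifier are the usual abbreviations. -/
inductive Formula (R : Signature.{u}) (C : Type u) (n : ℕ) : Type u where
  | truth : Formula R C n
  | rel (r : R.Sym) (ts : Fin (R.arity r) → Term C n) : Formula R C n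
  | eq (s t : Term C n) : Formula R C n
  | not (φ : Formula R C n) : Formula R C n
  | and (φ ψ : Formula R C n) : Formula R C n
  | or (φ ψ : Formula R C n) : Formula R C n
  | ex (x : ℕ) (φ : Formula R C n) : Formula R C n

namespace Formula

variable {R : Signature.{u}} {C : Type u} {n : ℕ}

def freeVars : Formula R C n → Set ℕ
  | truth => ∅
  | rel _ ts => ⋃ i, (ts i).vars
  | eq s t => s.vars ∪ t.vars
  | not φ => φ.freeVars
  | and φ ψ => φ.freeVars ∪ ψ.freeVars
  | or φ ψ => φ.freeVars ∪ ψ.freeVars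
  | ex x φ => φ.freeVars \ {x}

def params : Formula R C n → Set (Fin n)
  | truth => ∅
  | rel _ ts => ⋃ i, (ts i).params
  | eq s t => s.params ∪ t.params
  | not φ => φ.params
  | and φ ψ => φ.params ∪ ψ.params
  | or φ ψ => φ.params ∪ ψ.params
  | ex _ φ => φ.params

def consts : Formula R C n → Set C
  | truth => ∅
  | rel _ ts => ⋃ i, (ts i).consts
  | eq s t => s.consts ∪ t.consts
  | not φ => φ.consts
  | and φ ψ => φ.consts ∪ ψ.consts
  | or φ ψ => φ.consts ∪ ψ.consts
  | ex _ φ => φ.consts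

/-- Conjunctive queries: built from atoms by conjunction and existential quantification. -/
inductive IsCQ : Formula R C n → Prop
  | truth : IsCQ truth
  | rel (r : R.Sym) (ts : Fin (R.arity r) → Term C n) : IsCQ (rel r ts)
  | eq (s t : Term C n) : IsCQ (eq s t)
  | and {φ ψ : Formula R C n} : IsCQ φ → IsCQ ψ → IsCQ (and φ ψ)
  | ex (x : ℕ) {φ : Formula R C n} : IsCQ φ → IsCQ (ex x φ)

/-- Unions of conjunctive queries. -/
inductive IsUCQ : Formula R C n → Prop
  | cq {φ : Formula R C n} : IsCQ φ → IsUCQ φ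
  | or {φ ψ : Formula R C n} : IsUCQ φ → IsUCQ ψ → IsUCQ (or φ ψ)

/-- Satisfaction in the instance `I`, with quantifiers ranging over `D`. -/
def Sat (D : Set C) (I : Instance R C) (σ : Fin n → C) : (ℕ → C) → Formula R C n → Prop
  | _, truth => True
  | θ, rel r ts => (⟨r, fun i => (ts i).eval σ θ⟩ : Fact R C) ∈ I
  | θ, eq s t => s.eval σ θ = t.eval σ θ
  | θ, not φ => ¬ Sat D I σ θ φ
  | θ, and φ ψ => Sat D I σ θ φ ∧ Sat D I σ θ ψ
  | θ, or φ ψ => Sat D I σ θ φ ∨ Sat D I σ θ ψ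
  | θ, ex x φ => ∃ d ∈ D, Sat D I σ (Function.update θ x d) φ

/-- `θ` is an answer to the query `φ` over `I`: its free variables are assigned values of the domain
`D` so that `φ` becomes true. -/
def IsAnswer (D : Set C) (I : Instance R C) (σ : Fin n → C) (φ : Formula R C n) (θ : ℕ → C) :
    Prop :=
  (∀ x ∈ φ.freeVars, θ x ∈ D) ∧ φ.Sat D I σ θ

end Formula

/-! ### The data layer -/

/-- An equality constraint `Q → ⋀ⱼ zⱼ = yⱼ`. -/
structure EqConstraint (R : Signature.{u}) (C : Type u) where
  query : Formula R C 0
  eqs : Finset (Term C 0 × Term C 0)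
  eqs_vars : ∀ e ∈ eqs, e.1.vars ∪ e.2.vars ⊆ query.freeVars

namespace EqConstraint

variable {R : Signature.{u}} {C : Type u}

def consts (κ : EqConstraint R C) : Set C :=
  κ.query.consts ∪ ⋃ e ∈ κ.eqs, (e.1.consts ∪ e.2.consts)

/-- The constraint holds in `I`, the query being evaluated over the domain `D`. -/
def Holds (κ : EqConstraint R C) (D : Set C) (I : Instance R C) : Prop :=
  ∀ θ : ℕ → C, κ.query.IsAnswer D I Fin.elim0 θ →
    ∀ e ∈ κ.eqs, e.1.eval Fin.elim0 θ = e.2.eval Fin.elim0 θ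

end EqConstraint

/-- A data layer over the set of constants `C`: a schema, equality constraints, and an initial
instance that satisfies them. All constants in the constraints occur in the initial instance. -/
structure DataLayer (C : Type u) where
  schema : Signature.{u}
  constraints : Finset (EqConstraint schema C)
  init : Instance schema C
  consts_constraints : ∀ κ ∈ constraints, κ.consts ⊆ adom init
  init_sat : ∀ κ ∈ constraints, κ.Holds (adom init) init

namespace DataLayer

variable {C : Type u} (D : DataLayer C)

/-- The domain over which queries are evaluated in `I`: the values of `I` and the constants that
queries can mention, which are those of the initial instance. -/
def evalDom (I : Instance D.schema C) : Set C :=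
  adom I ∪ adom D.init

/-- The instance satisfies all equality constraints. -/
def Consistent (I : Instance D.schema C) : Prop :=
  ∀ κ ∈ D.constraints, κ.Holds (D.evalDom I) I

end DataLayer

/-! ### The process layer -/

/-- Terms in the head of an effect: plain terms and (unnested) service calls on plain terms. -/
inductive EffTerm (F : Signature.{u}) (C : Type u) (n : ℕ) : Type u where
  | base (t : Term C n) : EffTerm F C n
  | call (f : F.Sym) (args : Fin (F.arity f) → Term C n) : EffTerm F C n

namespace EffTerm

variable {F : Signature.{u}} {C : Type u} {n : ℕ}

def vars : EffTerm F C n → Set ℕ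
  | base t => t.vars
  | call _ args => ⋃ i, (args i).vars

def consts : EffTerm F C n → Set C
  | base t => t.consts
  | call _ args => ⋃ i, (args i).consts

/-- Instantiation: a constant, or a ground service call. -/
def ground (σ : Fin n → C) (θ : ℕ → C) : EffTerm F C n → C ⊕ Fact F C
  | base t => Sum.inl (t.eval σ θ)
  | call f args => Sum.inr ⟨f, fun i => (args i).eval σ θ⟩

end EffTerm

/-- An effect specification `q⁺ ∧ Q⁻ ⇝ E` of an action with `n` parameters, where all constants
come from the set `K`. -/
structure Effect (R F : Signature.{u}) {C : Type u} (K : Set C) (n : ℕ) where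
  pos : Formula R C n
  neg : Formula R C n
  head : Finset (Fact R (EffTerm F C n))
  pos_ucq : pos.IsUCQ
  neg_vars : neg.freeVars ⊆ pos.freeVars
  head_vars : ∀ e ∈ head, ∀ i, (e.2 i).vars ⊆ pos.freeVars
  pos_consts : pos.consts ⊆ K
  neg_consts : neg.consts ⊆ K
  head_consts : ∀ e ∈ head, ∀ i, (e.2 i).consts ⊆ K

/-- An action: its number of parameters and its effect specifications. -/
structure Action (R F : Signature.{u}) {C : Type u} (K : Set C) where
  numParams : ℕ
  effects : Finset (Effect R F K numParams)

/-- A condition-action rule `Q ↦ α`. In `Q`, the parameters of `α` play the role of the free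
variables; all other variables are quantified. -/
structure Rule (R F : Signature.{u}) {C : Type u} (K : Set C) {A : Type u}
    (act : A → Action R F K) where
  action : A
  guard : Formula R C (act action).numParams
  guard_vars : guard.freeVars = ∅
  guard_params : guard.params = Set.univ
  guard_consts : guard.consts ⊆ K

/-- A process layer over a data layer: services, (named) actions and condition-action rules. -/
structure ProcessLayer {C : Type u} (D : DataLayer C) where
  services : Signature.{u}
  ActionName : Type u
  finite_actionName : Finite ActionName
  action : ActionName → Action D.schema services (adom D.init)
  rules : Finset (Rule D.schema services (adom D.init) action)

end DCDSys

/-- A data-centric dynamic system over the set of constants `C`. -/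
structure DCDS (C : Type u) where
  data : DCDSys.DataLayer C
  process : DCDSys.ProcessLayer data

namespace DCDSys

/-! ### Transition systems -/

/-- Transition systems whose states are labelled by database instances over the schema `R` with
values in `Δ`. -/
structure TransitionSystem (Δ : Type u) (R : Signature.{u}) where
  State : Type u
  init : State
  db : State → Instance R Δ
  step : State → State → Prop

namespace TransitionSystem

variable {Δ : Type u} {R : Signature.{u}}

/-- A finite or infinite run: the states `state 0, state 1, …` up to index `len`, where
`len = ⊤` for an infinite run. Entries of `state` beyond `len` are irrelevant. -/
structure Run (T : TransitionSystem Δ R) where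
  len : ℕ∞
  state : ℕ → T.State
  start : state 0 = T.init
  step : ∀ i : ℕ, (i : ℕ∞) < len → T.step (state i) (state (i + 1))

/-- The values that occur in the databases of a run. -/
def Run.values {T : TransitionSystem Δ R} (τ : T.Run) : Set Δ :=
  {c | ∃ i : ℕ, (i : ℕ∞) ≤ τ.len ∧ c ∈ adom (T.db (τ.state i))}

/-- There is a common finite bound on the number of values that occur in a run. -/
def RunBounded (T : TransitionSystem Δ R) : Prop :=
  ∃ b : ℕ, ∀ τ : T.Run, τ.values.encard < (b : ℕ∞)

/-- The partial bijection `h` induces an isomorphism between the instances `I₁` and `I₂`: it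
restricts to a bijection between the active domains that preserves and reflects facts. -/
def InducesIso (h : Δ ≃. Δ) (I₁ I₂ : Instance R Δ) : Prop :=
  (∀ c ∈ adom I₁, ∃ d ∈ adom I₂, h c = some d) ∧
  (∀ d ∈ adom I₂, ∃ c ∈ adom I₁, h c = some d) ∧
  ∀ (r : R.Sym) (c d : Fin (R.arity r) → Δ), (∀ i, h (c i) = some (d i)) →
    ((⟨r, c⟩ : Fact R Δ) ∈ I₁ ↔ (⟨r, d⟩ : Fact R Δ) ∈ I₂)

/-- `B` is a history-preserving bisimulation between `T₁` and `T₂`, where all partial bijections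
are the identity on the set `K` of constants. Extension of partial bijections is `h ≤ h'`. -/
def IsHistoryBisimulation (K : Set Δ) (T₁ T₂ : TransitionSystem Δ R)
    (B : T₁.State → (Δ ≃. Δ) → T₂.State → Prop) : Prop :=
  ∀ s₁ h s₂, B s₁ h s₂ →
    (∀ c ∈ K, h c = some c) ∧
    InducesIso h (T₁.db s₁) (T₂.db s₂) ∧
    (∀ s₁', T₁.step s₁ s₁' → ∃ s₂' h', T₂.step s₂ s₂' ∧ h ≤ h' ∧ B s₁' h' s₂') ∧
    (∀ s₂', T₂.step s₂ s₂' → ∃ s₁' h', T₁.step s₁ s₁' ∧ h ≤ h' ∧ B s₁' h' s₂')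

/-- History-preserving bisimilarity `T₁ ≈ T₂`, with the constants in `K` fixed. -/
def HistoryBisimilar (K : Set Δ) (T₁ T₂ : TransitionSystem Δ R) : Prop :=
  ∃ B, IsHistoryBisimulation K T₁ T₂ B ∧ ∃ h₀, B T₁.init h₀ T₂.init

end TransitionSystem

end DCDSys

/-! ### Semantics with deterministic services -/

namespace DCDS

open DCDSys

variable {C : Type u} (S : DCDS C)

/-- Ground service calls `f(v₁, …, vₙ)`. -/
abbrev ServiceCall : Type u := Fact S.process.services C

/-- Service call maps: partial functions from service calls to constants. -/
abbrev CallMap : Type u := S.ServiceCall → Option C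

/-- Concrete states: an instance together with the results of all service calls made so far. -/
abbrev ConcreteState : Type u := Instance S.data.schema C × S.CallMap

/-- The initial instance, with no service call made. -/
def concreteInit : S.ConcreteState := (S.data.init, fun _ => none)

/-- `DO(I, ασ)`: the facts, possibly containing service calls, that result from applying the
effects of the action `a` with parameters `σ` to `I`. -/
def doAction (I : Instance S.data.schema C) (a : S.process.ActionName)
    (σ : Fin (S.process.action a).numParams → C) : Set (Fact S.data.schema (C ⊕ S.ServiceCall)) :=
  {g | ∃ ε ∈ (S.process.action a).effects, ∃ θ : ℕ → C,
    (ε.pos.and ε.neg).IsAnswer (S.data.evalDom I) I σ θ ∧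
    ∃ e ∈ ε.head, g = ⟨e.1, fun i => (e.2 i).ground σ θ⟩}

/-- The service calls that occur in a set of facts. -/
def callsIn (E : Set (Fact S.data.schema (C ⊕ S.ServiceCall))) : Set S.ServiceCall :=
  {t | ∃ g ∈ E, ∃ i, g.2 i = Sum.inr t}

/-- `M'` is a possible result of answering all service calls in `E`: calls already recorded in `M`
keep their value, and exactly the new calls in `E` receive an arbitrary value. -/
def ServiceCalls (E : Set (Fact S.data.schema (C ⊕ S.ServiceCall))) (M M' : S.CallMap) : Prop :=
  ∀ t, (M t ≠ none → M' t = M t) ∧ (M t = none → ((∃ v, M' t = some v) ↔ t ∈ S.callsIn E))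

/-- The value of a constant or service call under a service call map. -/
def callValue (M : S.CallMap) : C ⊕ S.ServiceCall → Option C
  | Sum.inl c => some c
  | Sum.inr t => M t

/-- `M(E)`: the set of facts obtained from `E` by replacing service calls by their values. -/
def applyCalls (M : S.CallMap) (E : Set (Fact S.data.schema (C ⊕ S.ServiceCall))) :
    Set (Fact S.data.schema C) :=
  {e | ∃ (r : S.data.schema.Sym) (t : Fin (S.data.schema.arity r) → C ⊕ S.ServiceCall)
      (c : Fin (S.data.schema.arity r) → C),
    (⟨r, t⟩ : Fact S.data.schema (C ⊕ S.ServiceCall)) ∈ E ∧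
      (∀ i, S.callValue M (t i) = some (c i)) ∧ e = ⟨r, c⟩}

/-- `σ` is a legal parameter assignment in `I` for the action guarded by the rule `ρ`: it is an
answer to the guard. -/
def Legal (I : Instance S.data.schema C)
    (ρ : Rule S.data.schema S.process.services (adom S.data.init) S.process.action)
    (σ : Fin (S.process.action ρ.action).numParams → C) : Prop :=
  (∀ p, σ p ∈ S.data.evalDom I) ∧
    ∀ θ : ℕ → C, ρ.guard.Sat (S.data.evalDom I) I σ θ

/-- Concrete execution of some action, allowed by some rule, from the state `s` to `s'`. -/
def Exec (s s' : S.ConcreteState) : Prop :=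
  ∃ ρ ∈ S.process.rules, ∃ σ : Fin (S.process.action ρ.action).numParams → C,
    S.Legal s.1 ρ σ ∧
    S.ServiceCalls (S.doAction s.1 ρ.action σ) s.2 s'.2 ∧
    (s'.1 : Set (Fact S.data.schema C)) = S.applyCalls s'.2 (S.doAction s.1 ρ.action σ) ∧
    S.data.Consistent s'.1

/-- The concrete transition system for deterministic services: its states are those reachable from
the initial one. -/
def cts : TransitionSystem C S.data.schema where
  State := {s : S.ConcreteState // Relation.ReflTransGen S.Exec S.concreteInit s}
  init := ⟨S.concreteInit, Relation.ReflTransGen.refl⟩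
  db s := s.1.1
  step s s' := S.Exec s.1 s'.1

/-- A system with deterministic services is run-bounded if its concrete transition system is. -/
def RunBounded : Prop := S.cts.RunBounded

end DCDS

/-! A permutation of the constants that fixes `adom S.data.init` is an automorphism of the execution
relation, because queries, constraints and effects mention no other constants (`exec_map`). It
remains to choose finitely many values from which every run can be copied up to renaming.

With deterministic services nothing is forgotten. A value outside the initial instance can only
enter as the result of a service call, and the call map keeps all calls with their results, so
`stateValues` grows along runs (`stateValues_mono`). Conversely, every remembered value has occurred
in some database of the run: call arguments come from the evaluation domain of the state that issues
the call, and results appear in the next instance (`stateValues_step`, `exists_run`). A run bound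
`b` thus bounds the number of values that any reachable state remembers.

Let `A` be a set of `b` constants that contains the initial ones. The abstraction consists of the
reachable states with all remembered values in `A`; there are finitely many. A state `s` is related
to its renamings `π s`, with the restriction of `π` to `stateValues s` as partial bijection. Steps
of the abstraction are copied by applying `π`. For a step from `π s` to `s₂'`, the inverse of `π` is
changed outside the values of `π s` so that it maps the at most `b` values of `s₂'` into `A`
(`exists_perm_mapsTo`). Since `π s` does not see the change, the renamed step starts in `s`, and its
inverse renaming extends the old bijection. -/

namespace DCDSys

/-! ### Renaming of values -/

section Rename

variable {R : Signature.{u}} {Δ Δ' : Type u}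

/-- Renaming the values of a fact. -/
def mapFact (π : Δ ≃ Δ') : Fact R Δ ≃ Fact R Δ' where
  toFun e := ⟨e.1, fun i => π (e.2 i)⟩
  invFun e := ⟨e.1, fun i => π.symm (e.2 i)⟩
  left_inv e := by simp
  right_inv e := by simp

@[simp] theorem mapFact_mk (π : Δ ≃ Δ') (r : R.Sym) (t : Fin (R.arity r) → Δ) :
    mapFact π (⟨r, t⟩ : Fact R Δ) = ⟨r, fun i => π (t i)⟩ := rfl

theorem mapFact_symm (π : Δ ≃ Δ') : (mapFact (R := R) π).symm = mapFact π.symm := rfl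

theorem mapFact_apply_eq_of_eqOn {π π' : Δ ≃ Δ'} (e : Fact R Δ)
    (h : ∀ i, π (e.2 i) = π' (e.2 i)) : mapFact π e = mapFact π' e :=
  Sigma.ext rfl (heq_of_eq (funext h))

/-- Renaming the values of an instance. -/
def mapInstance (π : Δ ≃ Δ') (I : Instance R Δ) : Instance R Δ' :=
  I.map (mapFact π).toEmbedding

@[simp] theorem mapFact_mem_mapInstance (π : Δ ≃ Δ') (I : Instance R Δ) (e : Fact R Δ) :
    mapFact π e ∈ mapInstance π I ↔ e ∈ I := by
  simp [mapInstance]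

theorem mem_mapInstance (π : Δ ≃ Δ') (I : Instance R Δ) (e : Fact R Δ') :
    e ∈ mapInstance π I ↔ ∃ e' ∈ I, mapFact π e' = e :=
  Finset.mem_map

theorem coe_mapInstance (π : Δ ≃ Δ') (I : Instance R Δ) :
    (mapInstance π I : Set (Fact R Δ')) = mapFact π '' (I : Set (Fact R Δ)) := by
  ext e
  exact mem_mapInstance π I e

theorem mapInstance_symm_mapInstance (π : Δ ≃ Δ') (I : Instance R Δ) :
    mapInstance π.symm (mapInstance π I) = I := by
  ext e
  rw [← mapFact_mem_mapInstance π I e, ← mapFact_mem_mapInstance π.symm, ← mapFact_symm,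
    Equiv.symm_apply_apply]

theorem adom_mapInstance (π : Δ ≃ Δ') (I : Instance R Δ) :
    adom (mapInstance π I) = π '' adom I := by
  ext c
  constructor
  · rintro ⟨e, he, i, rfl⟩
    obtain ⟨e', he', rfl⟩ := (mem_mapInstance π I e).1 he
    exact ⟨e'.2 i, ⟨e', he', i, rfl⟩, rfl⟩
  · rintro ⟨_, ⟨e, he, i, rfl⟩, rfl⟩
    exact ⟨mapFact π e, by simpa using he, i, rfl⟩

theorem finite_adom (I : Instance R Δ) : (adom I).Finite := by
  have : adom I = ⋃ e ∈ I, Set.range e.2 := by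
    ext c; simp [adom]
  rw [this]
  exact I.finite_toSet.biUnion fun e _ => Set.finite_range e.2

theorem mapInstance_eq_of_eqOn {π π' : Δ ≃ Δ'} (I : Instance R Δ)
    (h : ∀ c ∈ adom I, π c = π' c) : mapInstance π I = mapInstance π' I := by
  have key : ∀ e ∈ I, mapFact π e = mapFact π' e := fun e he =>
    mapFact_apply_eq_of_eqOn e fun i => h _ ⟨e, he, i, rfl⟩
  ext e
  simp only [mem_mapInstance]
  exact exists_congr fun e' => and_congr_right fun he' => by rw [key e' he']

/-- There are finitely many facts with values in a finite set. -/
theorem finite_facts {A : Set Δ} (hA : A.Finite) : {e : Fact R Δ | ∀ i, e.2 i ∈ A}.Finite := by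
  have := R.finite_sym
  have := hA.to_subtype
  let f : (Σ r : R.Sym, (Fin (R.arity r) → A)) → Fact R Δ := fun e => ⟨e.1, fun i => e.2 i⟩
  refine (Set.finite_range f).subset fun e he => ⟨⟨e.1, fun i => ⟨e.2 i, he i⟩⟩, rfl⟩

end Rename

/-! ### Queries are invariant under renaming -/

section Query

variable {R F : Signature.{u}} {C : Type u} {n : ℕ}

theorem Term.eval_map (π : Equiv.Perm C) (σ : Fin n → C) (θ : ℕ → C) (t : Term C n)
    (ht : ∀ c ∈ t.consts, π c = c) : t.eval (π ∘ σ) (π ∘ θ) = π (t.eval σ θ) := by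
  cases t with
  | var x => rfl
  | par p => rfl
  | const c => exact (ht c rfl).symm

theorem Term.eval_mem {D : Set C} {σ : Fin n → C} {θ : ℕ → C} {t : Term C n}
    (hv : ∀ x ∈ t.vars, θ x ∈ D) (hσ : ∀ p, σ p ∈ D) (hc : t.consts ⊆ D) : t.eval σ θ ∈ D := by
  cases t with
  | var x => exact hv x rfl
  | par p => exact hσ p
  | const c => exact hc rfl

/-- Induction on the formula. The equivalence, rather than one implication, carries the induction
through negation; injectivity of `π` handles equality, and the quantifier range moves along with
`π`. -/
theorem Formula.sat_map (π : Equiv.Perm C) (D : Set C) (I : Instance R C) (σ : Fin n → C)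
    (φ : Formula R C n) : ∀ (θ : ℕ → C), (∀ c ∈ φ.consts, π c = c) →
      (φ.Sat (π '' D) (mapInstance π I) (π ∘ σ) (π ∘ θ) ↔ φ.Sat D I σ θ) := by
  induction φ with
  | truth => intro θ _; exact Iff.rfl
  | rel r ts =>
    intro θ hc
    have : (fun i => (ts i).eval (π ∘ σ) (π ∘ θ)) = fun i => π ((ts i).eval σ θ) :=
      funext fun i => (ts i).eval_map π σ θ fun c h => hc c (Set.mem_iUnion.2 ⟨i, h⟩)
    simp only [Formula.Sat, this]
    exact mapFact_mem_mapInstance π I ⟨r, fun i => (ts i).eval σ θ⟩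
  | eq s t =>
    intro θ hc
    simp only [Formula.Sat, s.eval_map π σ θ fun c h => hc c (Or.inl h),
      t.eval_map π σ θ fun c h => hc c (Or.inr h), π.apply_eq_iff_eq]
  | not φ ih => intro θ hc; exact not_congr (ih θ hc)
  | and φ ψ ih₁ ih₂ =>
    intro θ hc
    exact and_congr (ih₁ θ fun c h => hc c (Or.inl h)) (ih₂ θ fun c h => hc c (Or.inr h))
  | or φ ψ ih₁ ih₂ =>
    intro θ hc
    exact or_congr (ih₁ θ fun c h => hc c (Or.inl h)) (ih₂ θ fun c h => hc c (Or.inr h))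
  | ex x φ ih =>
    intro θ hc
    simp only [Formula.Sat, Set.exists_mem_image]
    refine exists_congr fun d => and_congr_right fun _ => ?_
    rw [← ih (Function.update θ x d) hc, Function.comp_update]

theorem Formula.isAnswer_map (π : Equiv.Perm C) (D : Set C) (I : Instance R C) (σ : Fin n → C)
    (φ : Formula R C n) (θ : ℕ → C) (hc : ∀ c ∈ φ.consts, π c = c) :
    φ.IsAnswer (π '' D) (mapInstance π I) (π ∘ σ) (π ∘ θ) ↔ φ.IsAnswer D I σ θ := by
  simp only [Formula.IsAnswer, φ.sat_map π D I σ θ hc, Function.comp_apply,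
    π.injective.mem_set_image]

theorem EffTerm.ground_map (π : Equiv.Perm C) (σ : Fin n → C) (θ : ℕ → C) (t : EffTerm F C n)
    (ht : ∀ c ∈ t.consts, π c = c) :
    t.ground (π ∘ σ) (π ∘ θ) = Equiv.sumCongr π (mapFact π) (t.ground σ θ) := by
  cases t with
  | base t => exact congrArg Sum.inl (t.eval_map π σ θ ht)
  | call f args =>
    refine congrArg Sum.inr (Sigma.ext rfl (heq_of_eq (funext fun i => ?_)))
    exact (args i).eval_map π σ θ fun c h => ht c (Set.mem_iUnion.2 ⟨i, h⟩)

theorem EqConstraint.holds_map (π : Equiv.Perm C) (κ : EqConstraint R C) (D : Set C)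
    (I : Instance R C) (hc : ∀ c ∈ κ.consts, π c = c) (h : κ.Holds D I) :
    κ.Holds (π '' D) (mapInstance π I) := by
  intro θ hθ e he
  have hσ : (Fin.elim0 : Fin 0 → C) = π ∘ Fin.elim0 := Subsingleton.elim _ _
  -- Any assignment is the renaming of another one, so invariance of answers applies.
  have hπ : θ = π ∘ (π.symm ∘ θ) := by ext x; simp
  rw [hσ, hπ] at hθ ⊢
  rw [Formula.isAnswer_map π D I _ _ _ fun c h => hc c (Or.inl h)] at hθ
  have hce : ∀ c ∈ e.1.consts ∪ e.2.consts, π c = c := fun c h =>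
    hc c (Or.inr (Set.mem_biUnion he h))
  rw [e.1.eval_map π _ _ fun c h => hce c (Or.inl h),
    e.2.eval_map π _ _ fun c h => hce c (Or.inr h), h _ hθ e he]

end Query

/-- A permutation that maps the finite set `A` into `E` can be changed outside `A` so as to map a
larger set `A ∪ B` into `E`, if `E` is large enough. -/
theorem exists_perm_mapsTo {α : Type*} [DecidableEq α] (A B E : Finset α) (π : Equiv.Perm α)
    (hA : ∀ x ∈ A, π x ∈ E) (hcard : (A ∪ B).card ≤ E.card) :
    ∃ π' : Equiv.Perm α, (∀ x ∈ A, π' x = π x) ∧ ∀ x ∈ A ∪ B, π' x ∈ E := by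
  induction B using Finset.induction_on with
  | empty => exact ⟨π, fun _ _ => rfl, by simpa using hA⟩
  | insert a B _ ih =>
    obtain ⟨π₁, h₁, h₂⟩ := ih ((Finset.card_le_card (by grind)).trans hcard)
    by_cases ha : π₁ a ∈ E
    · exact ⟨π₁, h₁, by grind⟩
    · have haAB : a ∉ A ∪ B := fun h => ha (h₂ a h)
      -- By counting, `E` has a point `c` not yet used by `A ∪ B`. Swapping `π₁ a` with `c` repairs
      -- the value at `a` and leaves the values on `A ∪ B` alone.
      have hlt : ((A ∪ B).image π₁).card < E.card := by
        rw [Finset.card_image_of_injective _ π₁.injective]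
        rw [Finset.union_insert, Finset.card_insert_of_notMem haAB] at hcard
        omega
      obtain ⟨c, hcE, hc⟩ := Finset.exists_mem_notMem_of_card_lt_card hlt
      have hsame : ∀ x ∈ A ∪ B, (π₁.trans (Equiv.swap (π₁ a) c)) x = π₁ x := fun x hx =>
        Equiv.swap_apply_of_ne_of_ne (fun h => haAB (π₁.injective h ▸ hx))
          (fun h => hc (h ▸ Finset.mem_image_of_mem _ hx))
      refine ⟨π₁.trans (Equiv.swap (π₁ a) c), fun x hx => ?_, fun x hx => ?_⟩
      · rw [hsame x (Finset.mem_union_left _ hx), h₁ x hx]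
      · rw [Finset.union_insert, Finset.mem_insert] at hx
        rcases hx with rfl | hx
        · simpa using hcE
        · rw [hsame x hx]; exact h₂ x hx

end DCDSys

namespace DCDS

open DCDSys

variable {C : Type u} (S : DCDS C)

/-! ### Executions are invariant under renaming -/

/-- Renaming constants, also inside service calls. -/
abbrev renameArg (π : Equiv.Perm C) : C ⊕ S.ServiceCall ≃ C ⊕ S.ServiceCall :=
  Equiv.sumCongr π (mapFact π)

/-- Renaming the arguments and results of a service call map. -/
def mapCalls (π : Equiv.Perm C) (M : S.CallMap) : S.CallMap :=
  fun t => (M ((mapFact π).symm t)).map π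

/-- Renaming the values of a concrete state. -/
def mapState (π : Equiv.Perm C) (s : S.ConcreteState) : S.ConcreteState :=
  (mapInstance π s.1, S.mapCalls π s.2)

/-- The constants of the initial instance are fixed by `π`. -/
def FixesInit (π : Equiv.Perm C) : Prop :=
  ∀ c ∈ adom S.data.init, π c = c

variable {S}

theorem FixesInit.symm {π : Equiv.Perm C} (hπ : S.FixesInit π) : S.FixesInit π.symm :=
  fun c hc => by rw [Equiv.symm_apply_eq, hπ c hc]

theorem FixesInit.image {π : Equiv.Perm C} (hπ : S.FixesInit π) :
    π '' adom S.data.init = adom S.data.init := by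
  rw [Set.image_congr hπ, Set.image_id']

theorem mapCalls_mapFact (π : Equiv.Perm C) (M : S.CallMap) (t : S.ServiceCall) :
    S.mapCalls π M (mapFact π t) = (M t).map π := by
  simp [mapCalls]

theorem mapState_symm_mapState (π : Equiv.Perm C) (s : S.ConcreteState) :
    S.mapState π.symm (S.mapState π s) = s := by
  refine Prod.ext (mapInstance_symm_mapInstance π s.1) (funext fun t => ?_)
  change ((s.2 _).map π).map π.symm = _
  rw [mapFact_symm, mapFact_symm, Equiv.symm_symm, ← mapFact_symm, Equiv.symm_apply_apply]
  simp

theorem mapState_init {π : Equiv.Perm C} (hπ : S.FixesInit π) :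
    S.mapState π S.concreteInit = S.concreteInit := by
  refine Prod.ext ?_ (funext fun t => rfl)
  change mapInstance π S.data.init = S.data.init
  rw [mapInstance_eq_of_eqOn (π' := Equiv.refl C) S.data.init hπ]
  ext e
  exact mapFact_mem_mapInstance (Equiv.refl C) S.data.init e

theorem evalDom_mapInstance {π : Equiv.Perm C} (hπ : S.FixesInit π)
    (I : Instance S.data.schema C) :
    S.data.evalDom (mapInstance π I) = π '' S.data.evalDom I := by
  rw [DataLayer.evalDom, DataLayer.evalDom, Set.image_union, hπ.image, adom_mapInstance]

theorem consistent_map {π : Equiv.Perm C} (hπ : S.FixesInit π) {I : Instance S.data.schema C}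
    (h : S.data.Consistent I) : S.data.Consistent (mapInstance π I) := by
  intro κ hκ
  rw [evalDom_mapInstance hπ]
  exact κ.holds_map π _ I (fun c hc => hπ c (S.data.consts_constraints κ hκ hc)) (h κ hκ)

theorem legal_map {π : Equiv.Perm C} (hπ : S.FixesInit π) {I : Instance S.data.schema C}
    {ρ : Rule S.data.schema S.process.services (adom S.data.init) S.process.action}
    {σ : Fin (S.process.action ρ.action).numParams → C} (h : S.Legal I ρ σ) :
    S.Legal (mapInstance π I) ρ (π ∘ σ) := by
  rw [Legal, evalDom_mapInstance hπ]
  refine ⟨fun p => ⟨σ p, h.1 p, rfl⟩, fun θ => ?_⟩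
  have hθ : θ = π ∘ (π.symm ∘ θ) := by ext x; simp
  rw [hθ, Formula.sat_map π _ _ _ _ _ fun c hc => hπ c (ρ.guard_consts hc)]
  exact h.2 _

theorem mapFact_mem_doAction {π : Equiv.Perm C} (hπ : S.FixesInit π)
    {I : Instance S.data.schema C} {a : S.process.ActionName}
    {σ : Fin (S.process.action a).numParams → C}
    {g : Fact S.data.schema (C ⊕ S.ServiceCall)} (hg : g ∈ S.doAction I a σ) :
    mapFact (S.renameArg π) g ∈ S.doAction (mapInstance π I) a (π ∘ σ) := by
  obtain ⟨ε, hε, θ, hθ, e, he, rfl⟩ := hg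
  refine ⟨ε, hε, π ∘ θ, ?_, e, he, ?_⟩
  · rw [evalDom_mapInstance hπ, Formula.isAnswer_map]
    · exact hθ
    · rintro c (hc | hc)
      · exact hπ c (ε.pos_consts hc)
      · exact hπ c (ε.neg_consts hc)
  · refine Sigma.ext rfl (heq_of_eq (funext fun i => ?_))
    exact ((e.2 i).ground_map π σ θ fun c hc => hπ c (ε.head_consts e he i hc)).symm

theorem renameArg_symm (π : Equiv.Perm C) : (S.renameArg π).symm = S.renameArg π.symm := rfl

/-- The remaining inclusion is `mapFact_mem_doAction` for `π.symm`. -/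
theorem doAction_mapInstance {π : Equiv.Perm C} (hπ : S.FixesInit π)
    (I : Instance S.data.schema C) (a : S.process.ActionName)
    (σ : Fin (S.process.action a).numParams → C) :
    S.doAction (mapInstance π I) a (π ∘ σ) = mapFact (S.renameArg π) '' S.doAction I a σ := by
  ext g
  constructor
  · intro hg
    have := mapFact_mem_doAction hπ.symm hg
    rw [mapInstance_symm_mapInstance, ← Function.comp_assoc, Equiv.symm_comp_self,
      Function.id_comp, ← renameArg_symm, ← mapFact_symm] at this
    exact ⟨_, this, Equiv.apply_symm_apply _ _⟩
  · rintro ⟨g, hg, rfl⟩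
    exact mapFact_mem_doAction hπ hg

theorem mapFact_mem_callsIn (π : Equiv.Perm C) (E : Set (Fact S.data.schema (C ⊕ S.ServiceCall)))
    (t : S.ServiceCall) :
    mapFact π t ∈ S.callsIn (mapFact (S.renameArg π) '' E) ↔ t ∈ S.callsIn E := by
  constructor
  · rintro ⟨_, ⟨g, hg, rfl⟩, i, hi⟩
    exact ⟨g, hg, i, (S.renameArg π).injective hi⟩
  · rintro ⟨g, hg, i, hi⟩
    exact ⟨_, ⟨g, hg, rfl⟩, i, congrArg (S.renameArg π) hi⟩

theorem serviceCalls_map (π : Equiv.Perm C) {E : Set (Fact S.data.schema (C ⊕ S.ServiceCall))}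
    {M M' : S.CallMap} (h : S.ServiceCalls E M M') :
    S.ServiceCalls (mapFact (S.renameArg π) '' E) (S.mapCalls π M) (S.mapCalls π M') := by
  intro t
  obtain ⟨t, rfl⟩ := (mapFact π).surjective t
  obtain ⟨h₁, h₂⟩ := h t
  rw [mapCalls_mapFact, mapCalls_mapFact, mapFact_mem_callsIn]
  refine ⟨fun ht => by rw [h₁ fun h0 => ht (by rw [h0]; rfl)], fun ht => ?_⟩
  rw [← h₂ (Option.map_eq_none_iff.1 ht)]
  cases M' t <;> simp

theorem callValue_map (π : Equiv.Perm C) (M : S.CallMap) (x : C ⊕ S.ServiceCall) :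
    S.callValue (S.mapCalls π M) (S.renameArg π x) = (S.callValue M x).map π := by
  cases x with
  | inl c => rfl
  | inr t => exact mapCalls_mapFact π M t

theorem applyCalls_map (π : Equiv.Perm C) {M : S.CallMap}
    {E : Set (Fact S.data.schema (C ⊕ S.ServiceCall))} :
    S.applyCalls (S.mapCalls π M) (mapFact (S.renameArg π) '' E) =
      mapFact π '' S.applyCalls M E := by
  ext e
  constructor
  · rintro ⟨r, t, c, ⟨⟨r, t'⟩, hg, h⟩, hc, rfl⟩
    obtain ⟨rfl, h⟩ := Sigma.mk.inj_iff.1 h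
    obtain rfl := eq_of_heq h
    refine ⟨⟨r, fun i => π.symm (c i)⟩, ⟨r, t', _, hg, fun i => ?_, rfl⟩, by simp⟩
    have := hc i
    rw [callValue_map, Option.map_eq_some_iff] at this
    obtain ⟨a, ha, hac⟩ := this
    rw [ha, ← hac, Equiv.symm_apply_apply]
  · rintro ⟨_, ⟨r, t, c, hg, hc, rfl⟩, rfl⟩
    refine ⟨r, _, _, ⟨_, hg, rfl⟩, fun i => ?_, rfl⟩
    rw [callValue_map, hc i]; rfl

theorem exec_map {π : Equiv.Perm C} (hπ : S.FixesInit π) {s s' : S.ConcreteState}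
    (h : S.Exec s s') : S.Exec (S.mapState π s) (S.mapState π s') := by
  obtain ⟨ρ, hρ, σ, hl, hc, ha, hk⟩ := h
  refine ⟨ρ, hρ, π ∘ σ, legal_map hπ hl, ?_, ?_, consistent_map hπ hk⟩
  · simp only [mapState, doAction_mapInstance hπ]
    exact serviceCalls_map π hc
  · simp only [mapState, doAction_mapInstance hπ, coe_mapInstance, applyCalls_map, ha]

theorem reachable_map {π : Equiv.Perm C} (hπ : S.FixesInit π) {s : S.ConcreteState}
    (h : Relation.ReflTransGen S.Exec S.concreteInit s) :
    Relation.ReflTransGen S.Exec S.concreteInit (S.mapState π s) := by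
  induction h with
  | refl => rw [mapState_init hπ]
  | tail _ h ih => exact ih.tail (exec_map hπ h)

/-! ### The values that a state remembers -/

variable (S) in
/-- The arguments and results of the calls made so far. -/
def callValues (s : S.ConcreteState) : Set C :=
  {c | ∃ t v, s.2 t = some v ∧ (c = v ∨ ∃ i, t.2 i = c)}

variable (S) in
/-- The values of the initial instance, of the current instance, and of all calls made so far. -/
def stateValues (s : S.ConcreteState) : Set C :=
  S.data.evalDom s.1 ∪ S.callValues s

theorem adom_subset_stateValues (s : S.ConcreteState) : adom s.1 ⊆ S.stateValues s :=
  fun _ h => Or.inl (Or.inl h)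

theorem init_subset_stateValues (s : S.ConcreteState) : adom S.data.init ⊆ S.stateValues s :=
  fun _ h => Or.inl (Or.inr h)

/-- This allows a renaming to be modified on values that a state does not remember. -/
theorem mapState_eq_of_eqOn {π π' : Equiv.Perm C} (s : S.ConcreteState)
    (h : ∀ c ∈ S.stateValues s, π c = π' c) : S.mapState π s = S.mapState π' s := by
  have hcall : ∀ t v, s.2 t = some v → mapFact π t = mapFact π' t ∧ π v = π' v := fun t v ht =>
    ⟨mapFact_apply_eq_of_eqOn t fun i => h _ (Or.inr ⟨t, v, ht, Or.inr ⟨i, rfl⟩⟩),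
      h _ (Or.inr ⟨t, v, ht, Or.inl rfl⟩)⟩
  refine Prod.ext (mapInstance_eq_of_eqOn _ fun c hc => h c (adom_subset_stateValues s hc))
    (funext fun t => Option.ext fun v => ?_)
  -- Describing the renamed map by its graph ensures that `π` is evaluated only at arguments and
  -- results of recorded calls.
  have key : ∀ π : Equiv.Perm C, S.mapCalls π s.2 t = some v ↔
      ∃ t' v', s.2 t' = some v' ∧ mapFact π t' = t ∧ π v' = v := by
    intro π
    obtain ⟨t, rfl⟩ := (mapFact π).surjective t
    rw [mapCalls_mapFact, Option.map_eq_some_iff]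
    constructor
    · rintro ⟨a, ha, rfl⟩
      exact ⟨t, a, ha, rfl, rfl⟩
    · rintro ⟨t', a, ha, ht, rfl⟩
      obtain rfl := (mapFact π).injective ht
      exact ⟨a, ha, rfl⟩
  change S.mapCalls π s.2 t = some v ↔ S.mapCalls π' s.2 t = some v
  rw [key, key]
  refine exists_congr fun t' => exists_congr fun v' => and_congr_right fun ht => ?_
  rw [(hcall t' v' ht).1, (hcall t' v' ht).2]

theorem stateValues_mapState {π : Equiv.Perm C} (hπ : S.FixesInit π) (s : S.ConcreteState) :
    S.stateValues (S.mapState π s) = π '' S.stateValues s := by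
  have key : ∀ {π : Equiv.Perm C}, S.FixesInit π → ∀ s : S.ConcreteState, ∀ c ∈ S.stateValues s,
      π c ∈ S.stateValues (S.mapState π s) := by
    rintro π hπ s c (hc | ⟨t, v, ht, hc⟩)
    · left
      change π c ∈ S.data.evalDom (mapInstance π s.1)
      rw [evalDom_mapInstance hπ]
      exact ⟨c, hc, rfl⟩
    · refine Or.inr ⟨mapFact π t, π v, ?_, ?_⟩
      · change S.mapCalls π s.2 (mapFact π t) = _
        rw [mapCalls_mapFact, ht]; rfl
      · rcases hc with rfl | ⟨i, rfl⟩
        · exact Or.inl rfl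
        · exact Or.inr ⟨i, rfl⟩
  ext c
  constructor
  · intro hc
    have := key hπ.symm _ c hc
    rw [mapState_symm_mapState] at this
    exact ⟨_, this, π.apply_symm_apply c⟩
  · rintro ⟨c, hc, rfl⟩
    exact key hπ s c hc

theorem serviceCalls_mono {E : Set (Fact S.data.schema (C ⊕ S.ServiceCall))}
    {M M' : S.CallMap} (h : S.ServiceCalls E M M') {t : S.ServiceCall} {v : C}
    (ht : M t = some v) : M' t = some v := by
  rw [(h t).1 (by simp [ht]), ht]

/-- The calls issued by a legal action have arguments in the evaluation domain. -/
theorem callsIn_args_mem {I : Instance S.data.schema C}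
    {ρ : Rule S.data.schema S.process.services (adom S.data.init) S.process.action}
    {σ : Fin (S.process.action ρ.action).numParams → C} (hl : S.Legal I ρ σ)
    {t : S.ServiceCall} (ht : t ∈ S.callsIn (S.doAction I ρ.action σ)) (j) :
    t.2 j ∈ S.data.evalDom I := by
  obtain ⟨_, ⟨ε, hε, θ, hθ, e, he, rfl⟩, i, hi⟩ := ht
  have hv := ε.head_vars e he i
  have hk := ε.head_consts e he i
  change (e.2 i).ground σ θ = _ at hi
  generalize e.2 i = x at hi hv hk
  cases x with
  | base t => cases hi
  | call f args =>
    cases hi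
    refine Term.eval_mem (fun x hx => ?_) hl.1 fun c hc => Or.inr (hk (Set.mem_iUnion.2 ⟨j, hc⟩))
    exact hθ.1 x (Or.inl (hv (Set.mem_iUnion.2 ⟨j, hx⟩)))

/-- After a step, the result of every issued call occurs in the instance. -/
theorem call_result_mem_adom {E : Set (Fact S.data.schema (C ⊕ S.ServiceCall))}
    {M M' : S.CallMap} {I' : Instance S.data.schema C} (h : S.ServiceCalls E M M')
    (hI : (I' : Set (Fact S.data.schema C)) = S.applyCalls M' E) {t : S.ServiceCall} {v : C}
    (ht : t ∈ S.callsIn E) (hv : M' t = some v) : v ∈ adom I' := by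
  obtain ⟨⟨r, g⟩, hg, i, hi⟩ := ht
  -- `applyCalls` keeps a fact only if all of its arguments have values, so the other calls in the
  -- same fact must be answered too.
  have hdef : ∀ j, ∃ c, S.callValue M' (g j) = some c := by
    intro j
    rcases hj : g j with c | t'
    · exact ⟨c, rfl⟩
    · rcases hM : M t' with _ | w
      · exact ((h t').2 hM).2 ⟨_, hg, j, hj⟩
      · exact ⟨w, serviceCalls_mono h hM⟩
  choose c hc using hdef
  have hmem : (⟨r, c⟩ : Fact S.data.schema C) ∈ I' := by
    rw [← Finset.mem_coe, hI]
    exact ⟨r, g, c, hg, hc, rfl⟩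
  refine ⟨_, hmem, i, ?_⟩
  have := hc i
  change g i = _ at hi
  rw [hi] at this
  exact Option.some.inj (this.symm.trans hv)

/-- A newly recorded call has its arguments in the evaluation domain of `s` and its result in the
instance of `s'`. -/
theorem stateValues_step {s s' : S.ConcreteState} (h : S.Exec s s') :
    S.stateValues s' ⊆ S.stateValues s ∪ adom s'.1 := by
  obtain ⟨ρ, -, σ, hl, hc, ha, -⟩ := h
  rintro c ((hc' | hc') | ⟨t, v, ht, hc'⟩)
  · exact Or.inr hc'
  · exact Or.inl (Or.inl (Or.inr hc'))
  · rcases hM : s.2 t with _ | w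
    · have hin : t ∈ S.callsIn (S.doAction s.1 ρ.action σ) := ((hc t).2 hM).1 ⟨v, ht⟩
      rcases hc' with rfl | ⟨i, rfl⟩
      · exact Or.inr (call_result_mem_adom hc ha hin ht)
      · exact Or.inl (Or.inl (callsIn_args_mem hl hin i))
    · obtain rfl : w = v := Option.some.inj ((serviceCalls_mono hc hM).symm.trans ht)
      exact Or.inl (Or.inr ⟨t, w, hM, hc'⟩)

theorem callValues_mono {s s' : S.ConcreteState} (h : S.Exec s s') :
    S.callValues s ⊆ S.callValues s' := by
  obtain ⟨ρ, -, σ, -, hc, -, -⟩ := h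
  rintro c ⟨t, v, ht, hc'⟩
  exact ⟨t, v, serviceCalls_mono hc ht, hc'⟩

theorem adom_step {s s' : S.ConcreteState} (h : S.Exec s s') :
    adom s'.1 ⊆ S.data.evalDom s.1 ∪ S.callValues s' := by
  obtain ⟨ρ, -, σ, hl, -, ha, -⟩ := h
  rintro c ⟨e, he, i, rfl⟩
  rw [← Finset.mem_coe, ha] at he
  obtain ⟨r, g, c, ⟨ε, hε, θ, hθ, e, he, hg⟩, hc, rfl⟩ := he
  obtain ⟨rfl, hg⟩ := Sigma.mk.inj_iff.1 hg
  obtain rfl := eq_of_heq hg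
  have hv := ε.head_vars e he i
  have hk := ε.head_consts e he i
  have hi : S.callValue s'.2 ((e.2 i).ground σ θ) = some (c i) := hc i
  change c i ∈ _
  generalize e.2 i = x at hi hv hk
  cases x with
  | base t =>
    rw [← Option.some.inj hi]
    exact Or.inl (Term.eval_mem (fun x hx => hθ.1 x (Or.inl (hv hx))) hl.1
      fun c hc => Or.inr (hk hc))
  | call f args => exact Or.inr ⟨_, _, hi, Or.inl rfl⟩

/-- Plain terms in effects only copy known values, so every other value is a call result, and
recorded calls are never dropped. -/
theorem adom_subset_of_reachable {s : S.ConcreteState}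
    (h : Relation.ReflTransGen S.Exec S.concreteInit s) :
    adom s.1 ⊆ adom S.data.init ∪ S.callValues s := by
  induction h with
  | refl => exact Set.subset_union_left
  | tail _ h ih =>
    intro c hc
    rcases adom_step h hc with (hc | hc) | hc
    · exact (ih hc).imp_right fun hc => callValues_mono h hc
    · exact Or.inl hc
    · exact Or.inr hc

/-- No value is forgotten along a run. -/
theorem stateValues_mono {s s' : S.ConcreteState}
    (hs : Relation.ReflTransGen S.Exec S.concreteInit s) (h : S.Exec s s') :
    S.stateValues s ⊆ S.stateValues s' := by
  rintro c ((hc | hc) | hc)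
  -- A value of the current instance may be absent from the next one; it survives as an initial
  -- constant or in the call map.
  · rcases adom_subset_of_reachable hs hc with hc | hc
    · exact init_subset_stateValues s' hc
    · exact Or.inr (callValues_mono h hc)
  · exact init_subset_stateValues s' hc
  · exact Or.inr (callValues_mono h hc)

/-- Every reachable state ends a finite run in which all its values occur. -/
theorem exists_run {s : S.ConcreteState}
    (h : Relation.ReflTransGen S.Exec S.concreteInit s) :
    ∃ (τ : S.cts.Run) (n : ℕ), τ.len = n ∧ (τ.state n).1 = s ∧ S.stateValues s ⊆ τ.values := by
  induction h with
  | refl =>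
    refine ⟨⟨0, fun _ => S.cts.init, rfl, fun i hi => absurd hi (by simp)⟩, 0, rfl, rfl, ?_⟩
    rintro c ((hc | hc) | ⟨t, v, ht, -⟩)
    · exact ⟨0, by simp, hc⟩
    · exact ⟨0, by simp, hc⟩
    · cases ht
  | @tail s s' hs h ih =>
    obtain ⟨τ, n, hn, hτ, hval⟩ := ih
    -- The run is prolonged by `s'` at index `n + 1`; later entries are irrelevant.
    let st : ℕ → S.cts.State := fun i => if i ≤ n then τ.state i else ⟨s', hs.tail h⟩
    have hst : ∀ i ≤ n, st i = τ.state i := fun i hi => if_pos hi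
    have hlast : st (n + 1) = ⟨s', hs.tail h⟩ := if_neg (by omega)
    refine ⟨⟨(n + 1 : ℕ), st, (hst 0 (by omega)).trans τ.start, fun i hi => ?_⟩, n + 1, rfl,
      congrArg Subtype.val hlast, ?_⟩
    · have hi : i < n + 1 := by exact_mod_cast hi
      rcases Nat.lt_succ_iff_lt_or_eq.1 hi with hi | rfl
      · rw [hst i hi.le, hst (i + 1) hi]
        exact τ.step i (by rw [hn]; exact_mod_cast hi)
      · rw [hst i le_rfl, hlast]
        change S.Exec (τ.state i).1 s'
        rwa [hτ]
    · intro c hc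
      rcases stateValues_step h hc with hc | hc
      · obtain ⟨i, hi, hci⟩ := hval hc
        rw [hn] at hi
        have hi : i ≤ n := by exact_mod_cast hi
        refine ⟨i, Nat.cast_le.2 (by omega : i ≤ n + 1), ?_⟩
        change c ∈ adom (S.cts.db (st i))
        rwa [hst i hi]
      · refine ⟨n + 1, le_rfl, ?_⟩
        change c ∈ adom (S.cts.db (st (n + 1)))
        rwa [hlast]

/-! ### The finite abstraction -/

variable (S) in
/-- The restriction of the concrete transition system to the states with values in `A`. -/
def restrictedSystem (A : Set C) (hA : adom S.data.init ⊆ A) :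
    TransitionSystem C S.data.schema where
  State := {s : S.ConcreteState // Relation.ReflTransGen S.Exec S.concreteInit s ∧
    S.stateValues s ⊆ A}
  init := ⟨S.concreteInit, Relation.ReflTransGen.refl, by
    rintro c ((hc | hc) | ⟨t, v, ht, -⟩)
    · exact hA hc
    · exact hA hc
    · cases ht⟩
  db s := s.1.1
  step s s' := S.Exec s.1 s'.1

/-- A state is determined by its set of facts over `A` and the graph of its call map, which are
subsets of two finite sets. -/
theorem finite_restrictedSystem {A : Set C} (hA : adom S.data.init ⊆ A) (hfin : A.Finite) :
    Finite (S.restrictedSystem A hA).State := by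
  classical
  have hF : {e : Fact S.data.schema C | ∀ i, e.2 i ∈ A}.Finite := finite_facts hfin
  have hT : {t : S.ServiceCall | ∀ i, t.2 i ∈ A}.Finite := finite_facts hfin
  have := hF.to_subtype
  have := hT.to_subtype
  have := hfin.to_subtype
  let code : (S.restrictedSystem A hA).State →
      Set {e : Fact S.data.schema C | ∀ i, e.2 i ∈ A} ×
        Set ({t : S.ServiceCall | ∀ i, t.2 i ∈ A} × A) :=
    fun s => ({e | e.1 ∈ s.1.1}, {p | s.1.2 p.1.1 = some p.2.1})
  refine Finite.of_injective code fun s s' hss => ?_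
  obtain ⟨h₁, h₂⟩ := Prod.ext_iff.1 hss
  have key₁ : ∀ s s' : (S.restrictedSystem A hA).State,
      (code s).1 = (code s').1 → s.1.1 ⊆ s'.1.1 := fun s s' h e he =>
    (Set.ext_iff.1 h ⟨e, fun i => s.2.2 (Or.inl (Or.inl ⟨e, he, i, rfl⟩))⟩).1 he
  have key₂ : ∀ s s' : (S.restrictedSystem A hA).State,
      (code s).2 = (code s').2 → ∀ t v, s.1.2 t = some v → s'.1.2 t = some v :=
    fun s s' h t v ht =>
      (Set.ext_iff.1 h (⟨t, fun i => s.2.2 (Or.inr ⟨t, v, ht, Or.inr ⟨i, rfl⟩⟩)⟩,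
        ⟨v, s.2.2 (Or.inr ⟨t, v, ht, Or.inl rfl⟩)⟩)).1 ht
  refine Subtype.ext (Prod.ext (Finset.Subset.antisymm (key₁ s s' h₁) (key₁ s' s h₁.symm))
    (funext fun t => Option.ext fun v => ⟨key₂ s s' h₂ t v, key₂ s' s h₂.symm t v⟩))

/-- The restriction of a permutation to a set, as a partial bijection. -/
theorem exists_pequiv_restrict (π : Equiv.Perm C) (A : Set C) :
    ∃ h : C ≃. C, ∀ c d, h c = some d ↔ c ∈ A ∧ π c = d := by
  classical
  refine ⟨(PEquiv.ofSet A).trans π.toPEquiv, fun c d => ?_⟩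
  by_cases hc : c ∈ A <;> simp [PEquiv.trans, PEquiv.ofSet, hc]

theorem inducesIso_restrict {π : Equiv.Perm C} {A : Set C} {h : C ≃. C}
    (hh : ∀ c d, h c = some d ↔ c ∈ A ∧ π c = d) {I : Instance S.data.schema C}
    (hI : adom I ⊆ A) : TransitionSystem.InducesIso h I (mapInstance π I) := by
  refine ⟨fun c hc => ⟨π c, ?_, (hh _ _).2 ⟨hI hc, rfl⟩⟩, fun d hd => ?_, fun r c d hcd => ?_⟩
  · rw [adom_mapInstance]; exact ⟨c, hc, rfl⟩
  · rw [adom_mapInstance] at hd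
    obtain ⟨c, hc, rfl⟩ := hd
    exact ⟨c, hc, (hh _ _).2 ⟨hI hc, rfl⟩⟩
  · obtain rfl : (fun i => π (c i)) = d := funext fun i => ((hh _ _).1 (hcd i)).2
    exact (mapFact_mem_mapInstance π I ⟨r, c⟩).symm

theorem pequiv_le {π π' : Equiv.Perm C} {A A' : Set C} {h h' : C ≃. C}
    (hh : ∀ c d, h c = some d ↔ c ∈ A ∧ π c = d) (hh' : ∀ c d, h' c = some d ↔ c ∈ A' ∧ π' c = d)
    (hA : A ⊆ A') (hπ : ∀ c ∈ A, π' c = π c) : h ≤ h' := by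
  intro c d hcd
  obtain ⟨hc, rfl⟩ := (hh c d).1 hcd
  exact (hh' _ _).2 ⟨hA hc, hπ c hc⟩

/-- The restricted system is bisimilar to the concrete one if the set of values it may use
is at least as large as the set of values of any reachable state. -/
theorem historyBisimilar_restrictedSystem (A : Finset C) (hA : adom S.data.init ⊆ A)
    (hcard : ∀ s, Relation.ReflTransGen S.Exec S.concreteInit s →
      (S.stateValues s).encard ≤ A.card) :
    TransitionSystem.HistoryBisimilar (adom S.data.init) (S.restrictedSystem A hA) S.cts := by
  classical
  refine ⟨fun s₁ h s₂ => ∃ π : Equiv.Perm C, S.FixesInit π ∧ s₂.1 = S.mapState π s₁.1 ∧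
    ∀ c d, h c = some d ↔ c ∈ S.stateValues s₁.1 ∧ π c = d, ?_, ?_⟩
  · rintro ⟨s₁, hr₁, hA₁⟩ h ⟨s₂, hr₂⟩ ⟨π, hπ, hs, hh⟩
    obtain rfl : s₂ = S.mapState π s₁ := hs
    refine ⟨fun c hc => (hh c c).2 ⟨init_subset_stateValues s₁ hc, hπ c hc⟩,
      inducesIso_restrict hh (adom_subset_stateValues s₁), ?_, ?_⟩
    · rintro ⟨s₁', hr₁', hA₁'⟩ (hstep : S.Exec s₁ s₁')
      -- The permutation stays the same; only the domain of its restriction grows.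
      obtain ⟨h', hh'⟩ := exists_pequiv_restrict π (S.stateValues s₁')
      exact ⟨⟨_, reachable_map hπ hr₁'⟩, h', exec_map hπ hstep,
        pequiv_le hh hh' (stateValues_mono hr₁ hstep) fun _ _ => rfl, π, hπ, rfl, hh'⟩
    · rintro ⟨s₂', hr₂'⟩ (hstep : S.Exec (S.mapState π s₁) s₂')
      have hfin : (S.stateValues s₂').Finite :=
        Set.finite_of_encard_le_coe (hcard s₂' hr₂')
      have hmono := stateValues_mono hr₂ hstep
      have hback : π.symm '' S.stateValues (S.mapState π s₁) ⊆ A := by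
        rw [← stateValues_mapState hπ.symm, mapState_symm_mapState]
        exact hA₁
      have hunion : (hfin.subset hmono).toFinset ∪ hfin.toFinset = hfin.toFinset :=
        Finset.union_eq_right.2 (Set.Finite.toFinset_subset_toFinset.2 hmono)
      -- `τ` agrees with `π.symm` on the values of the current concrete state and moves those of
      -- `s₂'` into `A`.
      obtain ⟨τ, hτ, hτA⟩ := exists_perm_mapsTo (hfin.subset hmono).toFinset hfin.toFinset A π.symm
        (fun c hc => hback ⟨c, by simpa using hc, rfl⟩) (by
          rw [hunion]
          have := hcard s₂' hr₂'
          rw [hfin.encard_eq_coe_toFinset_card] at this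
          exact_mod_cast this)
      rw [hunion] at hτA
      simp only [Set.Finite.mem_toFinset] at hτ hτA
      have hτK : S.FixesInit τ := fun c hc => by
        rw [hτ c (init_subset_stateValues _ hc), hπ.symm c hc]
      have hτs : S.mapState τ (S.mapState π s₁) = s₁ := by
        rw [mapState_eq_of_eqOn _ hτ, mapState_symm_mapState]
      have hexec := exec_map hτK hstep
      rw [hτs] at hexec
      obtain ⟨h', hh'⟩ := exists_pequiv_restrict τ.symm (S.stateValues (S.mapState τ s₂'))
      refine ⟨⟨S.mapState τ s₂', reachable_map hτK hr₂', ?_⟩, h', hexec,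
        pequiv_le hh hh' (stateValues_mono hr₁ hexec) fun c hc => ?_, τ.symm, hτK.symm,
        (mapState_symm_mapState τ s₂').symm, hh'⟩
      · rw [stateValues_mapState hτK]
        rintro _ ⟨c, hc, rfl⟩
        exact hτA c hc
      -- On the values of `s₁`, `τ.symm` agrees with `π` because `τ` undoes `π` there; hence `h ≤
      -- h'`.
      · have hπc : π c ∈ S.stateValues (S.mapState π s₁) := by
          rw [stateValues_mapState hπ]; exact ⟨c, hc, rfl⟩
        rw [Equiv.symm_apply_eq, hτ _ hπc, Equiv.symm_apply_apply]
  · obtain ⟨h, hh⟩ := exists_pequiv_restrict (Equiv.refl C) (S.stateValues S.concreteInit)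
    exact ⟨h, Equiv.refl C, fun _ _ => rfl, (mapState_init fun _ _ => rfl).symm, hh⟩

end DCDS

theorem mainTheorem3 {C : Type u} [Countable C] [Infinite C] (S : DCDS C) (hS : S.RunBounded) :
    ∃ T : DCDSys.TransitionSystem C S.data.schema,
      Finite T.State ∧
        DCDSys.TransitionSystem.HistoryBisimilar (DCDSys.adom S.data.init) T S.cts := by
  obtain ⟨b, hb⟩ := hS
  have hcard : ∀ s, Relation.ReflTransGen S.Exec S.concreteInit s →
      (S.stateValues s).encard ≤ b := fun s hs => by
    obtain ⟨τ, -, -, -, hτ⟩ := DCDS.exists_run hs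
    exact (Set.encard_le_encard hτ).trans (hb τ).le
  have hfin := DCDSys.finite_adom S.data.init
  have hinit : hfin.toFinset.card ≤ b := by
    have := (Set.encard_le_encard (DCDS.init_subset_stateValues S.concreteInit)).trans
      (hcard _ Relation.ReflTransGen.refl)
    rw [hfin.encard_eq_coe_toFinset_card] at this
    exact_mod_cast this
  -- Infinitely many constants are available, so the initial ones can be padded to exactly `b`.
  obtain ⟨A, hA, hAb⟩ := Infinite.exists_superset_card_eq hfin.toFinset b hinit
  have hA : DCDSys.adom S.data.init ⊆ A := fun c hc => hA (by simpa using hc)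
  refine ⟨S.restrictedSystem A hA, DCDS.finite_restrictedSystem hA A.finite_toSet,
    DCDS.historyBisimilar_restrictedSystem A hA fun s hs => ?_⟩
  rw [hAb]
  exact hcard s hs
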